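/- Throughout, $\mathcal V=(\mathcal V_o,\otimes,e)$ is a commutative quantale (a complete lattice with a commutative monoid structure whose tensor preserves suprema in each variable) which is non-trivial (not a singleton), integral ($e=\top$) and without zero divisors ($r\otimes s=\bot$ implies $r=\bot$ or $s=\bot$). $\mathcal V\text{-}\mathsf{cat}$ denotes the $\mathcal V\text{-}\mathsf{cat}$-enriched category of small $\mathcal V$-categories and $\mathcal V$-functors, with $[\mathcal X,\mathcal Y](f,g)=\bigwedge_x\mathcal Y(fx,gx)$. $\mathsf{Set}$ and $\mathsf{Preord}=\mathbb 2\text{-}\mathsf{cat}$ are regarded as $\mathcal V\text{-}\mathsf{cat}$-categories: $\mathsf{Set}(X,Y)$ is the discrete $\mathcal V$-category (distance $e$ if $f=g$, $\bot$ otherwise), and $\mathsf{Preord}(X,Y)(f,g)$ is $e$ if $f\le g$ pointwise and $\bot$ otherwise. $D^{\mathcal V}:\mathsf{Set}\to\mathcal V\text{-}\mathsf{cat}$ is the discrete functor, $D=D^{\mathbb 2}$; $C:\mathsf{Preord}\to\mathsf{Set}$ takes connected components; $\mathsf d_*:\mathsf{Preord}\to\mathcal V\text{-}\mathsf{cat}$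 is given by $\mathsf d_*X(x',x)=e$ if $x'\le x$ and $\bot$ otherwise; $\mathsf c_*:\mathcal V\text{-}\mathsf{cat}\to\mathsf{Preord}$ is given by $x'\le x$ in $\mathsf c_*\mathcal X$ iff $\mathcal X(x',x)\ne\bot$. There are adjunctions $C\dashv D$ and $\mathsf c_*\dashv\mathsf d_*$, both $\mathcal V\text{-}\mathsf{cat}$-enriched. The $\mathcal V\text{-}\mathsf{cat}$-ification of an endofunctor $T:\mathsf{Set}\to\mathsf{Set}$ is the $\mathcal V\text{-}\mathsf{cat}$-enriched (pointwise) left Kan extension $T_{\mathcal V}=\mathrm{Lan}_{D^{\mathcal V}}(D^{\mathcal V}T):\mathcal V\text{-}\mathsf{cat}\to\mathcal V\text{-}\mathsf{cat}$ with unit $\alpha^{\mathcal V}:D^{\mathcal V}T\to T_{\mathcal V}D^{\mathcal V}$; for $\mathcal V=\mathbb 2$ one obtains the $\mathsf{Preord}$-ification $T_{\mathbb 2}$. For an endofunctor $S$ of a $\mathcal V\text{-}\mathsf{cat}$-category, $\mathsf{Coalg}(S)$ is the $\mathcal V\text{-}\mathsf{cat}$-category of $S$-coalgebras, with distances between coalgebra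 morphisms those of the underlying morphisms. **Theorem.** Let $\mathcal V$ be as above and $T:\mathsf{Set}\to\mathsf{Set}$ an arbitrary endofunctor. Then $T_{\mathbb 2}$ and $T_{\mathcal V}$ exist, and for any choice of them: 1. the units $\alpha^{\mathbb 2}:DT\to T_{\mathbb 2}D$ and $\alpha^{\mathcal V}:D^{\mathcal V}T\to T_{\mathcal V}D^{\mathcal V}$ are isomorphisms, and there is a natural isomorphism $\psi:\mathsf d_*T_{\mathbb 2}\to T_{\mathcal V}\mathsf d_*$ compatible with them (that is, $\psi_D\circ\mathsf d_*\alpha^{\mathbb 2}=\alpha^{\mathcal V}$ modulo the identity-on-objects isomorphism $D^{\mathcal V}\cong\mathsf d_*D$); 2. the adjunctions $C\dashv D$ and $\mathsf c_*\dashv\mathsf d_*$ lift to $\mathcal V\text{-}\mathsf{cat}$-adjunctions $$\widetilde C\dashv\widetilde D:\mathsf{Coalg}(T)\to\mathsf{Coalg}(T_{\mathbb 2}),\qquad \widetilde{\mathsf c}_*\dashv\widetilde{\mathsf d}_*:\mathsf{Coalg}(T_{\mathbb 2})\to\mathsf{Coalg}(T_{\mathcal V}),$$ where $\widetilde D(X,c)=(DX,\alpha^{\mathbb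 2}_X\circ Dc)$ and $\widetilde{\mathsf d}_*(X,c)=(\mathsf d_*X,\psi_X\circ\mathsf d_*c)$, where $\widetilde C$ and $\widetilde{\mathsf c}_*$ are likewise induced by natural transformations $CT_{\mathbb 2}\to TC$ and $\mathsf c_*T_{\mathcal V}\to T_{\mathbb 2}\mathsf c_*$, and where units and counits are carried by those of the base adjunctions; 3. $\widetilde{\mathsf d}_*\widetilde D:\mathsf{Coalg}(T)\to\mathsf{Coalg}(T_{\mathcal V})$ is a fully faithful $\mathcal V\text{-}\mathsf{cat}$-functor whose composite $\mathcal V\text{-}\mathsf{cat}$-left adjoint is $\widetilde C\,\widetilde{\mathsf c}_*$; thus $\mathsf{Coalg}(T)$ is a full enriched-reflective subcategory of $\mathsf{Coalg}(T_{\mathcal V})$; 4. the final $T$-coalgebra is the final $T_{\mathcal V}$-coalgebra: a $T$-coalgebra $Z$ is final iff $\widetilde{\mathsf d}_*\widetilde DZ$ is a final $T_{\mathcal V}$-coalgebra, and every final $T_{\mathcal V}$-coalgebra is isomorphic to $\widetilde{\mathsf d}_*\widetilde DZ$ for some final $T$-coalgebra $Z$. -/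

import Mathlib

open CategoryTheory CategoryTheory.Limits

universe u v w w₁ w₂ w₃ w₄ w₅ w₆

namespace VCatCoalg

/-! ### Quantales

A commutative quantale is a type `V` with `[CommMonoid V] [CompleteLattice V] [IsQuantale V]`:
the tensor is `*`, its unit `e` is `1`. -/

section Quantale

variable {V : Type v} [CommMonoid V] [CompleteLattice V] [IsQuantale V]

theorem mul_bot' (r : V) : r * ⊥ = ⊥ := by
  have h := IsQuantale.mul_sSup_distrib r (∅ : Set V)
  simpa only [sSup_empty, Set.mem_empty_iff_false, iSup_false, iSup_bot] using h

theorem bot_mul' (r : V) : ⊥ * r = ⊥ := by rw [mul_comm, mul_bot']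

theorem mul_mono' {a b c d : V} (h₁ : a ≤ b) (h₂ : c ≤ d) : a * c ≤ b * d := by
  have key : ∀ {x y z : V}, x ≤ y → z * x ≤ z * y := by
    intro x y z h
    have h' := IsQuantale.mul_sSup_distrib z ({x, y} : Set V)
    rw [sSup_pair, sup_eq_right.mpr h] at h'
    rw [h']
    exact le_iSup₂_of_le x (by simp) le_rfl
  calc a * c ≤ a * d := key h₂
    _ = d * a := mul_comm _ _
    _ ≤ d * b := key h₁
    _ = b * d := mul_comm _ _

/-- `V` is integral (`e = ⊤`) and has no zero divisors. -/
class IsIntegralNoZeroDiv (V : Type v) [CommMonoid V] [CompleteLattice V] : Prop where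
  one_eq_top : (1 : V) = ⊤
  eq_bot_or_eq_bot : ∀ r s : V, r * s = ⊥ → r = ⊥ ∨ s = ⊥

theorem one_ne_bot [Nontrivial V] : (1 : V) ≠ ⊥ := by
  intro h
  obtain ⟨x, y, hxy⟩ := exists_pair_ne V
  apply hxy
  rw [← mul_one x, ← mul_one y, h, mul_bot', mul_bot']

end Quantale

/-- The two-element quantale of truth values: tensor is conjunction, the unit is `True`. -/
def Two : Type := Prop

namespace Two

instance : CompleteLattice Two := inferInstanceAs (CompleteLattice Prop)

instance : CommMonoid Two where
  mul p q := And p q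
  one := True
  mul_assoc p q r := propext (and_assoc (a := p) (b := q) (c := r))
  one_mul p := propext ⟨fun h => h.2, fun h => ⟨trivial, h⟩⟩
  mul_one p := propext ⟨fun h => h.1, fun h => ⟨h, trivial⟩⟩
  mul_comm p q := propext (and_comm (a := p) (b := q))

instance : IsQuantale Two where
  mul_sSup_distrib p s := by
    apply le_antisymm
    · rintro ⟨hp, q, hq, h⟩
      exact (le_iSup₂ (f := fun y (_ : y ∈ s) => p * y) q hq) ⟨hp, h⟩
    · exact iSup₂_le fun q hq h => ⟨h.1, q, hq, h.2⟩
  sSup_mul_distrib s p := by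
    apply le_antisymm
    · rintro ⟨⟨q, hq, h⟩, hp⟩
      exact (le_iSup₂ (f := fun y (_ : y ∈ s) => y * p) q hq) ⟨h, hp⟩
    · exact iSup₂_le fun q hq h => ⟨⟨q, hq, h.1⟩, h.2⟩

/-- The element of `𝟚` given by a proposition. -/
def of (p : Prop) : Two := p

/-- The proposition given by an element of `𝟚`. -/
def Holds (p : Two) : Prop := p

open Classical in
/-- The quantale morphism `𝖽 : 𝟚 → V`, `0 ↦ ⊥`, `1 ↦ e`. -/
noncomputable def emb (V : Type v) [CommMonoid V] [CompleteLattice V] (p : Two) : V :=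
  if p.Holds then 1 else ⊥

section

variable {V : Type v} [CommMonoid V] [CompleteLattice V]

theorem emb_true {p : Two} (h : p.Holds) : emb V p = 1 := if_pos h

theorem emb_false {p : Two} (h : ¬ p.Holds) : emb V p = ⊥ := if_neg h

theorem emb_mono {p q : Two} (h : p ≤ q) : emb V p ≤ emb V q := by
  by_cases hp : p.Holds
  · rw [emb_true hp, emb_true (h hp)]
  · rw [emb_false hp]; exact bot_le

theorem emb_one : emb V (1 : Two) = 1 := emb_true trivial

theorem emb_mul [IsQuantale V] (p q : Two) : emb V (p * q) = emb V p * emb V q := by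
  by_cases hp : p.Holds
  · by_cases hq : q.Holds
    · rw [emb_true hp, emb_true hq, mul_one]; exact emb_true ⟨hp, hq⟩
    · rw [emb_false hq, mul_bot']; exact emb_false fun h => hq h.2
  · rw [emb_false hp, bot_mul']; exact emb_false fun h => hp h.1

end

end Two

/-! ### `V`-categories and `V`-functors -/

/-- A small `V`-category; `hom x' x` is the `V`-valued hom `𝒳(x', x)`. -/
structure VCat (V : Type v) [CommMonoid V] [CompleteLattice V] : Type (max (u + 1) v) where
  carrier : Type u
  hom : carrier → carrier → V
  one_le_hom : ∀ x, 1 ≤ hom x x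
  hom_mul_hom_le : ∀ x y z, hom x y * hom y z ≤ hom x z

namespace VCat

/-- A `V`-functor. -/
@[ext]
structure Hom {V : Type v} [CommMonoid V] [CompleteLattice V] (X Y : VCat.{u} V) : Type u where
  toFun : X.carrier → Y.carrier
  hom_le : ∀ x' x, X.hom x' x ≤ Y.hom (toFun x') (toFun x)

/-- The ordinary category `V-cat_o` of small `V`-categories and `V`-functors. -/
instance (V : Type v) [CommMonoid V] [CompleteLattice V] : Category (VCat.{u} V) where
  Hom := Hom
  id X := ⟨fun x => x, fun _ _ => le_rfl⟩
  comp f g := ⟨fun x => g.toFun (f.toFun x), fun _ _ => (f.hom_le _ _).trans (g.hom_le _ _)⟩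

end VCat

/-- Preorders are the categories over the two-element quantale. -/
abbrev PreordCat : Type (u + 1) := VCat.{u} Two

/-! ### `V-cat`-enriched categories, functors and adjunctions -/

/-- A `V-cat`-category with underlying ordinary category `C`: each hom-set carries the structure
of a `V`-category, and composition is a `V`-functor from the tensor product of the hom-objects.
(The associativity and unit axioms of the enriched composition are equations between functions on
objects, and hence the axioms of the ordinary category `C`.) -/
structure Enrichment (V : Type v) [CommMonoid V] [CompleteLattice V]
    (C : Type w₁) [Category.{w₂} C] where
  dist : ∀ {X Y : C}, (X ⟶ Y) → (X ⟶ Y) → V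
  one_le_dist : ∀ {X Y : C} (f : X ⟶ Y), 1 ≤ dist f f
  dist_mul_dist_le : ∀ {X Y : C} (f g h : X ⟶ Y), dist f g * dist g h ≤ dist f h
  dist_comp_le : ∀ {X Y Z : C} (f f' : X ⟶ Y) (g g' : Y ⟶ Z),
    dist f f' * dist g g' ≤ dist (f ≫ g) (f' ≫ g')

section Enriched

variable {V : Type v} [CommMonoid V] [CompleteLattice V]
variable {C : Type w₁} [Category.{w₂} C] {D : Type w₃} [Category.{w₄} D]

/-- `F` is a `V-cat`-functor: its actions on homs are `V`-functors.
A `V-cat`-natural transformation between `V-cat`-functors is the same as an ordinary one. -/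
def IsEnrichedFunctor (EC : Enrichment V C) (ED : Enrichment V D) (F : C ⥤ D) : Prop :=
  ∀ ⦃X Y : C⦄ (f g : X ⟶ Y), EC.dist f g ≤ ED.dist (F.map f) (F.map g)

/-- `F` is a fully faithful `V-cat`-functor: its actions on homs are isomorphisms of
`V`-categories. -/
structure IsEnrichedFullyFaithful (EC : Enrichment V C) (ED : Enrichment V D) (F : C ⥤ D) :
    Prop where
  bijective : ∀ X Y : C, Function.Bijective (fun f : X ⟶ Y => F.map f)
  dist_map : ∀ ⦃X Y : C⦄ (f g : X ⟶ Y), ED.dist (F.map f) (F.map g) = EC.dist f g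

/-- `adj` is a `V-cat`-adjunction: both functors are `V-cat`-functors, and the natural bijections
`D(L X, Y) ≅ C(X, R Y)` are isomorphisms of `V`-categories. -/
structure IsEnrichedAdjunction (EC : Enrichment V C) (ED : Enrichment V D)
    {L : C ⥤ D} {R : D ⥤ C} (adj : L ⊣ R) : Prop where
  left : IsEnrichedFunctor EC ED L
  right : IsEnrichedFunctor ED EC R
  dist_homEquiv : ∀ ⦃X : C⦄ ⦃Y : D⦄ (f g : L.obj X ⟶ Y),
    EC.dist (adj.homEquiv X Y f) (adj.homEquiv X Y g) = ED.dist f g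

end Enriched

/-! ### Enriched left Kan extensions -/

section Kan

variable {V : Type v} [CommMonoid V] [CompleteLattice V]
variable {A : Type w₁} [Category.{w₂} A] {B : Type w₃} [Category.{w₄} B]
  {X : Type w₅} [Category.{w₆} X]

/-- The `V-cat`-natural transformations `𝔹(J-, b) → 𝕏(H-, x)` of presheaves on `𝔸`. -/
@[ext]
structure PresheafHom (EB : Enrichment V B) (EX : Enrichment V X) (J : A ⥤ B) (H : A ⥤ X)
    (b : B) (x : X) where
  app : ∀ a : A, (J.obj a ⟶ b) → (H.obj a ⟶ x)
  dist_le : ∀ (a : A) (f g : J.obj a ⟶ b), EB.dist f g ≤ EX.dist (app a f) (app a g)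
  naturality : ∀ {a a' : A} (k : a' ⟶ a) (f : J.obj a ⟶ b),
    app a' (J.map k ≫ f) = H.map k ≫ app a f

/-- The `V`-valued hom of `[𝔸ᵒᵖ, V-cat](𝔹(J-, b), 𝕏(H-, x))`, that is, the infimum over `a` of the
distances in the internal homs `[𝔹(J a, b), 𝕏(H a, x)]`. -/
def PresheafHom.dist {EB : Enrichment V B} {EX : Enrichment V X} {J : A ⥤ B} {H : A ⥤ X}
    {b : B} {x : X} (σ τ : PresheafHom EB EX J H b x) : V :=
  ⨅ (a : A) (f : J.obj a ⟶ b), EX.dist (σ.app a f) (τ.app a f)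

/-- The comparison `𝕏(L b, x) → [𝔸ᵒᵖ, V-cat](𝔹(J-, b), 𝕏(H-, x))` induced by `α : H ⟶ L J`. -/
def PresheafHom.ofHom (EB : Enrichment V B) (EX : Enrichment V X) (J : A ⥤ B) (H : A ⥤ X)
    (L : B ⥤ X) (hL : IsEnrichedFunctor EB EX L) (α : H ⟶ J ⋙ L) [IsQuantale V] (b : B) (x : X)
    (φ : L.obj b ⟶ x) : PresheafHom EB EX J H b x where
  app a f := α.app a ≫ L.map f ≫ φ
  dist_le a f g := by
    have h₁ : EX.dist (L.map f) (L.map g) ≤ EX.dist (L.map f ≫ φ) (L.map g ≫ φ) := by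
      refine le_trans ?_ (EX.dist_comp_le (L.map f) (L.map g) φ φ)
      calc EX.dist (L.map f) (L.map g) = EX.dist (L.map f) (L.map g) * 1 := (mul_one _).symm
        _ ≤ _ := mul_mono' le_rfl (EX.one_le_dist φ)
    have h₂ : EX.dist (L.map f ≫ φ) (L.map g ≫ φ) ≤
        EX.dist (α.app a ≫ L.map f ≫ φ) (α.app a ≫ L.map g ≫ φ) := by
      refine le_trans ?_ (EX.dist_comp_le (α.app a) (α.app a) _ _)
      calc EX.dist (L.map f ≫ φ) (L.map g ≫ φ)
          = 1 * EX.dist (L.map f ≫ φ) (L.map g ≫ φ) := (one_mul _).symm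
        _ ≤ _ := mul_mono' (EX.one_le_dist (α.app a)) le_rfl
    exact (hL f g).trans (h₁.trans h₂)
  naturality k f := by
    have := α.naturality k
    simp only [Functor.comp_map] at this
    simp [reassoc_of% this]

/-- `α : H ⟶ L J` exhibits the `V-cat`-functor `L` as the `V-cat`-enriched left Kan extension of
`H` along `J`: for all `b` and `x`, the comparison
`𝕏(L b, x) → [𝔸ᵒᵖ, V-cat](𝔹(J-, b), 𝕏(H-, x))` is an isomorphism of `V`-categories, so that `L b`
is the colimit of `H` weighted by `𝔹(J-, b)`. -/
structure IsLeftKanExtension [IsQuantale V] (EB : Enrichment V B) (EX : Enrichment V X)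
    (J : A ⥤ B) (H : A ⥤ X) (L : B ⥤ X) (α : H ⟶ J ⋙ L) : Prop where
  enriched : IsEnrichedFunctor EB EX L
  bijective : ∀ (b : B) (x : X),
    Function.Bijective (PresheafHom.ofHom EB EX J H L enriched α b x)
  dist_eq : ∀ (b : B) (x : X) (φ ψ : L.obj b ⟶ x),
    (PresheafHom.ofHom EB EX J H L enriched α b x φ).dist
      (PresheafHom.ofHom EB EX J H L enriched α b x ψ) = EX.dist φ ψ

end Kan

/-! ### The `V-cat`-categories `Set`, `Preord` and `V-cat` -/

section Base

variable (V : Type v) [CommMonoid V] [CompleteLattice V] [IsQuantale V]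

/-- `V-cat` as a `V-cat`-category: `[𝒳, 𝒴](f, g) = ⋀ₓ 𝒴(f x, g x)`. -/
def vcatEnr : Enrichment V (VCat.{u} V) where
  dist {X Y} f g := ⨅ x : X.carrier, Y.hom (VCat.Hom.toFun f x) (VCat.Hom.toFun g x)
  one_le_dist {_ Y} _ := le_iInf fun _ => Y.one_le_hom _
  dist_mul_dist_le {_ Y} _ _ _ := le_iInf fun x =>
    (mul_mono' (iInf_le _ x) (iInf_le _ x)).trans (Y.hom_mul_hom_le _ _ _)
  dist_comp_le {_ _ Z} f f' g g' := le_iInf fun x => by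
    refine (mul_mono' ((iInf_le _ x).trans (VCat.Hom.hom_le g _ _))
      (iInf_le _ (VCat.Hom.toFun f' x))).trans (Z.hom_mul_hom_le _ _ _)

variable {V} in
/-- Change of base of an enrichment along `𝖽 : 𝟚 → V`. -/
noncomputable def Enrichment.changeBase {C : Type w₁} [Category.{w₂} C] (E : Enrichment Two C) :
    Enrichment V C where
  dist f g := Two.emb V (E.dist f g)
  one_le_dist f := Two.emb_one.symm.le.trans (Two.emb_mono (E.one_le_dist f))
  dist_mul_dist_le f g h := by
    rw [← Two.emb_mul]; exact Two.emb_mono (E.dist_mul_dist_le f g h)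
  dist_comp_le f f' g g' := by
    rw [← Two.emb_mul]; exact Two.emb_mono (E.dist_comp_le f f' g g')

/-- `Preord` as a `V-cat`-category: the distance of two monotone maps `f, g` is `e` if `f ≤ g`
pointwise, and `⊥` otherwise. -/
noncomputable def preordEnr : Enrichment V PreordCat.{u} := (vcatEnr Two).changeBase

open Classical in
/-- The discrete `V`-category on a set: self-distances are `e`, all others are `⊥`. -/
noncomputable def discObj (S : Type u) : VCat.{u} V where
  carrier := S
  hom x y := if x = y then 1 else ⊥
  one_le_hom x := by simp
  hom_mul_hom_le x y z := by
    by_cases h : x = y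
    · subst h; simp
    · simp only [h, if_false, bot_mul']; exact bot_le

theorem discObj_hom_eq {S : Type u} {x y : S} (h : x = y) : (discObj V S).hom x y = 1 := if_pos h

theorem discObj_hom_ne {S : Type u} {x y : S} (h : x ≠ y) : (discObj V S).hom x y = ⊥ := if_neg h

variable {V} in
/-- Every function out of a set is a `V`-functor out of the discrete `V`-category. -/
noncomputable def discLift {S : Type u} {X : VCat.{u} V} (f : S → X.carrier) : discObj V S ⟶ X where
  toFun := f
  hom_le := fun (x y : S) => by
    by_cases h : x = y
    · subst h; exact (discObj_hom_eq V rfl).le.trans (X.one_le_hom _)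
    · exact (discObj_hom_ne V h).le.trans bot_le

/-- `Set` as a `V-cat`-category: the homs are discrete `V`-categories. -/
noncomputable def setEnr : Enrichment V (Type u) where
  dist {X Y} f g := (discObj V (X ⟶ Y)).hom f g
  one_le_dist {X Y} f := (discObj V (X ⟶ Y)).one_le_hom f
  dist_mul_dist_le {X Y} f g h := (discObj V (X ⟶ Y)).hom_mul_hom_le f g h
  dist_comp_le f f' g g' := by
    by_cases h : f = f'
    · by_cases h' : g = g'
      · rw [discObj_hom_eq V h, discObj_hom_eq V h', discObj_hom_eq V (by rw [h, h']), one_mul]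
      · rw [discObj_hom_ne V h', mul_bot']; exact bot_le
    · rw [discObj_hom_ne V h, bot_mul']; exact bot_le

/-- The discrete functor `D^V : Set → V-cat`. For `V = 𝟚` this is `D : Set → Preord`. -/
noncomputable def disc : Type u ⥤ VCat.{u} V where
  obj S := discObj V S
  map {_ Y} f := discLift (X := discObj V Y) (fun x => f x)
  map_id _ := rfl
  map_comp _ _ := rfl

/-- The `V`-category `𝖽_* P` of a preorder `P`: the distance from `x'` to `x` is `e` if `x' ≤ x`,
and `⊥` otherwise. -/
noncomputable def dStarObj (P : PreordCat.{u}) : VCat.{u} V where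
  carrier := P.carrier
  hom x y := Two.emb V (P.hom x y)
  one_le_hom x := Two.emb_one.symm.le.trans (Two.emb_mono (P.one_le_hom x))
  hom_mul_hom_le x y z := by
    rw [← Two.emb_mul]; exact Two.emb_mono (P.hom_mul_hom_le x y z)

/-- The functor `𝖽_* : Preord → V-cat`, the identity on underlying functions. -/
noncomputable def dStar : PreordCat.{u} ⥤ VCat.{u} V where
  obj P := dStarObj V P
  map {P Q} f :=
    { toFun := f.toFun
      hom_le := fun x y => Two.emb_mono (f.hom_le x y) : VCat.Hom (dStarObj V P) (dStarObj V Q) }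
  map_id _ := rfl
  map_comp _ _ := rfl

/-- The identity-on-objects isomorphism `D^V ≅ 𝖽_* D`. -/
noncomputable def discIso : disc.{u} V ≅ disc.{u} Two ⋙ dStar V :=
  NatIso.ofComponents (fun S =>
    { hom := discLift (X := dStarObj V (discObj Two S)) (fun x => x)
      inv :=
        { toFun := fun x => x
          hom_le := fun (x y : S) => by
            by_cases h : x = y
            · subst h
              exact (Two.emb_mono le_top).trans
                ((Two.emb_true (V := V) (p := ⊤) trivial).le.trans ((discObj V S).one_le_hom x))
            · exact (Two.emb_false fun h' => (discObj_hom_ne Two h).le h').le.trans bot_le : VCat.Hom (dStarObj V (discObj Two S)) (discObj V S) }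
      hom_inv_id := rfl
      inv_hom_id := rfl }) (fun _ => rfl)

end Base

/-! ### The left adjoints -/

/-- The functor `C : Preord → Set` taking connected components: the quotient by the equivalence
relation generated by the order. -/
def conn : PreordCat.{u} ⥤ Type u where
  obj P := Quot (fun x y : P.carrier => (P.hom x y).Holds)
  map f := TypeCat.ofHom (Quot.map f.toFun fun x y h => f.hom_le x y h)
  map_id P := by ext x; induction x using Quot.ind; rfl
  map_comp f g := by ext x; induction x using Quot.ind; rfl

/-- The adjunction `C ⊣ D`; the unit maps a point to its component. -/
noncomputable def connAdj : conn.{u} ⊣ disc.{u} Two :=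
  Adjunction.mkOfHomEquiv
    { homEquiv := fun P S =>
        { toFun := fun f =>
            { toFun := fun x => f (Quot.mk _ x)
              hom_le := fun x y h => by
                rw [discObj_hom_eq Two (congrArg f (Quot.sound h))]
                trivial : VCat.Hom P (discObj Two S) }
          invFun := fun g => TypeCat.ofHom (Quot.lift g.toFun (by
              intro x y h
              by_contra hne
              have h' : (discObj Two S).hom (g.toFun x) (g.toFun y) ≤ ⊥ :=
                (discObj_hom_ne Two hne).le
              exact h' (g.hom_le x y h)))
          left_inv := fun f => by ext x; induction x using Quot.ind; rfl
          right_inv := fun g => rfl }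
      homEquiv_naturality_left_symm := fun f g => by ext x; induction x using Quot.ind; rfl
      homEquiv_naturality_right := fun f g => rfl }

section CStar

variable (V : Type v) [CommMonoid V] [CompleteLattice V] [IsQuantale V] [Nontrivial V]
  [IsIntegralNoZeroDiv V]

/-- The preorder `𝖼_* 𝒳`, with `x' ≤ x` iff `𝒳(x', x) ≠ ⊥`. -/
def cStarObj (X : VCat.{u} V) : PreordCat.{u} where
  carrier := X.carrier
  hom x y := Two.of (X.hom x y ≠ ⊥)
  one_le_hom x _ h := one_ne_bot (V := V) (le_bot_iff.mp ((X.one_le_hom x).trans h.le))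
  hom_mul_hom_le x y z h h0 := by
    rcases IsIntegralNoZeroDiv.eq_bot_or_eq_bot _ _
      (le_bot_iff.mp ((X.hom_mul_hom_le x y z).trans h0.le)) with h1 | h1
    · exact h.1 h1
    · exact h.2 h1

/-- The functor `𝖼_* : V-cat → Preord`, the identity on underlying functions. -/
def cStar : VCat.{u} V ⥤ PreordCat.{u} where
  obj X := cStarObj V X
  map {X Y} f :=
    { toFun := f.toFun
      hom_le := fun x y h h0 => h (le_bot_iff.mp ((f.hom_le x y).trans h0.le)) :
        VCat.Hom (cStarObj V X) (cStarObj V Y) }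
  map_id _ := rfl
  map_comp _ _ := rfl

/-- The adjunction `𝖼_* ⊣ 𝖽_*`; the hom bijections are the identity on underlying functions. -/
noncomputable def cStarAdj : cStar.{u} V ⊣ dStar.{u} V :=
  Adjunction.mkOfHomEquiv
    { homEquiv := fun X P =>
        { toFun := fun (f : VCat.Hom (cStarObj V X) P) =>
            { toFun := f.toFun
              hom_le := fun x y => by
                by_cases h : X.hom x y = ⊥
                · rw [h]; exact bot_le
                · refine le_trans le_top (le_of_eq ?_)
                  rw [← IsIntegralNoZeroDiv.one_eq_top (V := V)]
                  exact (Two.emb_true (f.hom_le x y h)).symm : VCat.Hom X (dStarObj V P) }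
          invFun := fun (g : VCat.Hom X (dStarObj V P)) =>
            { toFun := g.toFun
              hom_le := fun x y h => by
                by_contra hne
                exact h (le_bot_iff.mp ((g.hom_le x y).trans (Two.emb_false hne).le)) :
              VCat.Hom (cStarObj V X) P }
          left_inv := fun f => rfl
          right_inv := fun g => rfl }
      homEquiv_naturality_left_symm := fun f g => rfl
      homEquiv_naturality_right := fun f g => rfl }

end CStar

/-! ### `V-cat`-ifications -/

/-- `α : D^V T ⟶ T_V D^V` exhibits `TV` as the `V-cat`-ification of `T`, that is, as the
`V-cat`-enriched left Kan extension of `D^V T` along `D^V`. -/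
def IsVCatification (V : Type v) [CommMonoid V] [CompleteLattice V] [IsQuantale V]
    (T : Type u ⥤ Type u) (TV : VCat.{u} V ⥤ VCat.{u} V)
    (α : T ⋙ disc V ⟶ disc V ⋙ TV) : Prop :=
  IsLeftKanExtension (vcatEnr V) (vcatEnr V) (disc V) (T ⋙ disc V) TV α

/-! ### Coalgebras -/

section Coalg

variable {C : Type w₁} [Category.{w₂} C] {D : Type w₃} [Category.{w₄} D]

/-- The category of coalgebras of an endofunctor. -/
abbrev Coalg (T : C ⥤ C) := Endofunctor.Coalgebra T

/-- The `V-cat`-category `Coalg(T)`: distances of coalgebra morphisms are those of the underlying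
morphisms. -/
def coalgEnr {V : Type v} [CommMonoid V] [CompleteLattice V] (E : Enrichment V C) (T : C ⥤ C) :
    Enrichment V (Coalg T) where
  dist f g := E.dist f.f g.f
  one_le_dist f := E.one_le_dist f.f
  dist_mul_dist_le f g h := E.dist_mul_dist_le f.f g.f h.f
  dist_comp_le f f' g g' := E.dist_comp_le f.f f'.f g.f g'.f

/-- The lifting of `F : C ⥤ D` to coalgebras induced by `φ : F T ⟶ T' F`, sending `(X, c)` to
`(F X, φ_X ∘ F c)` and acting as `F` on morphisms. -/
@[simps]
def coalgLift (F : C ⥤ D) {T : C ⥤ C} {T' : D ⥤ D} (φ : T ⋙ F ⟶ F ⋙ T') :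
    Coalg T ⥤ Coalg T' where
  obj X := ⟨F.obj X.V, F.map X.str ≫ φ.app X.V⟩
  map {X Y} f := ⟨F.map f.f, by
    have h := φ.naturality f.f
    simp only [Functor.comp_map] at h
    rw [Category.assoc, ← h, ← F.map_comp_assoc, f.h, F.map_comp_assoc]⟩

/-- An adjunction `adj'` between categories of coalgebras lies over the adjunction `adj` between
the base categories: unit and counit of `adj'` are carried by unit and counit of `adj`. -/
def LiesOver {L : C ⥤ D} {R : D ⥤ C} {T : C ⥤ C} {T' : D ⥤ D} {φ : T ⋙ L ⟶ L ⋙ T'}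
    {ψ : T' ⋙ R ⟶ R ⋙ T} (adj' : coalgLift L φ ⊣ coalgLift R ψ) (adj : L ⊣ R) : Prop :=
  (∀ X : Coalg T, (adj'.unit.app X).f = adj.unit.app X.V) ∧
    ∀ Y : Coalg T', (adj'.counit.app Y).f = adj.counit.app Y.V

end Coalg

end VCatCoalg

/-! Two observations carry the theorem: one about coalgebras in general, one about the Kan
extension.

If `ψ` is an isomorphism exchanging a right adjoint `R` with the two endofunctors, then `R` lifts to
coalgebras via `ψ`, and `L` lifts via the mate of the inverse of `ψ`. The base unit and counit are
then coalgebra morphisms, so the adjunction lifts (`coalgAdj`). Everything enriched is inherited,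
since distances of coalgebra morphisms are computed in the base. Full faithfulness of `R` lifts as
well. What remains is to show that the units and the comparison `ψ` are isomorphisms; the claims on
final coalgebras are then general facts about reflective subcategories.

For the isomorphisms, the Kan extension is made explicit. A `V`-functor from a discrete `V`-category
into `X` is a function into the carrier of `X`, so it factors through the identity-on-points map
from the discrete category on that carrier. Hence a transformation of weights into `Y` is a single
function from `T X` to `Y`, subject to distance inequalities. So the extension is the set `T X` with
the least `V`-category structure in which `T f t` and `T g t` are at least as close as `f` and `g`
(`isVCatification_ext`). By integrality, on discrete objects this structure is discrete, and on
preorders it is the image of the one computed over `Two`. Uniqueness of Kan extensions transfers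
both facts to any choice of them. Absence of zero divisors serves to make the relation defining
`𝖼_*` transitive. -/

namespace VCatCoalg

/-! ### Lifting adjunctions to coalgebras -/

section Lift

variable {C : Type w₁} [Category.{w₂} C] {D : Type w₃} [Category.{w₄} D]
variable {L : C ⥤ D} {R : D ⥤ C} {T : C ⥤ C} {T' : D ⥤ D}

/-- The mate of the inverse of an isomorphism `T' R ⟶ R T` under an adjunction `L ⊣ R`. -/
@[simps]
noncomputable def mateOfIso (adj : L ⊣ R) (ψ : T' ⋙ R ⟶ R ⋙ T) [IsIso ψ] :
    T ⋙ L ⟶ L ⋙ T' where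
  app X := L.map (T.map (adj.unit.app X)) ≫ L.map ((inv ψ).app (L.obj X)) ≫
    adj.counit.app (T'.obj (L.obj X))
  naturality X Y f := by
    have h₁ := adj.unit.naturality f
    have h₂ := (inv ψ).naturality (L.map f)
    have h₃ := adj.counit.naturality (T'.map (L.map f))
    simp only [Functor.comp_map, Functor.id_map, Functor.comp_obj, Functor.id_obj] at h₁ h₂ h₃ ⊢
    rw [Category.assoc, Category.assoc, ← h₃, ← L.map_comp_assoc, ← T.map_comp, h₁,
      ← L.map_comp_assoc (inv ψ |>.app _), ← h₂]
    simp only [Functor.map_comp, Category.assoc]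

/-- Makes the base unit a coalgebra morphism; `mateOfIso_counit` does the same for the counit. -/
theorem unit_mateOfIso (adj : L ⊣ R) (ψ : T' ⋙ R ⟶ R ⋙ T) [IsIso ψ] (X : C) :
    adj.unit.app (T.obj X) ≫ R.map ((mateOfIso adj ψ).app X) ≫ ψ.app (L.obj X) =
      T.map (adj.unit.app X) := by
  -- Transposed along the adjunction, this equation is the definition of the mate.
  have h : adj.unit.app (T.obj X) ≫ R.map ((mateOfIso adj ψ).app X) =
      T.map (adj.unit.app X) ≫ (inv ψ).app (L.obj X) := by
    dsimp only [Functor.comp_obj, Functor.id_obj]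
    rw [adj.unit_comp_map_eq_iff, L.map_comp, Category.assoc]
    rfl
  rw [← Category.assoc, h, Category.assoc, ← NatTrans.comp_app, IsIso.inv_hom_id]
  simp

theorem mateOfIso_counit (adj : L ⊣ R) (ψ : T' ⋙ R ⟶ R ⋙ T) [IsIso ψ] (Y : D) :
    L.map (ψ.app Y) ≫ (mateOfIso adj ψ).app (R.obj Y) ≫ T'.map (adj.counit.app Y) =
      adj.counit.app (T'.obj Y) := by
  have h₁ := adj.counit.naturality (T'.map (adj.counit.app Y))
  have h₂ := (inv ψ).naturality (adj.counit.app Y)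
  simp only [Functor.comp_map, Functor.id_map, Functor.comp_obj, Functor.id_obj] at h₁ h₂
  have h₃ : ψ.app Y ≫ (inv ψ).app Y = 𝟙 _ := by
    rw [← NatTrans.comp_app, IsIso.hom_inv_id, NatTrans.id_app]
  rw [mateOfIso_app, Category.assoc, Category.assoc, ← h₁, ← L.map_comp_assoc (inv ψ |>.app _),
    ← h₂, ← L.map_comp_assoc (T.map _), ← T.map_comp_assoc, adj.right_triangle_components,
    ← L.map_comp_assoc, T.map_id, Category.id_comp, h₃, L.map_id, Category.id_comp]

theorem comp_map_unit (adj : L ⊣ R) (ψ : T' ⋙ R ⟶ R ⋙ T) [IsIso ψ] {X : C}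
    (c : X ⟶ T.obj X) :
    c ≫ T.map (adj.unit.app X) =
      adj.unit.app X ≫ R.map (L.map c ≫ (mateOfIso adj ψ).app X) ≫ ψ.app (L.obj X) := by
  have h := unit_mateOfIso adj ψ X
  dsimp only [Functor.comp_obj, Functor.id_obj] at h ⊢
  have h' := adj.unit_naturality c
  rw [R.map_comp, Category.assoc, reassoc_of% h', h]

theorem comp_map_counit (adj : L ⊣ R) (ψ : T' ⋙ R ⟶ R ⋙ T) [IsIso ψ] {Y : D}
    (d : Y ⟶ T'.obj Y) :
    (L.map (R.map d ≫ ψ.app Y) ≫ (mateOfIso adj ψ).app (R.obj Y)) ≫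
      T'.map (adj.counit.app Y) = adj.counit.app Y ≫ d := by
  have h := mateOfIso_counit adj ψ Y
  dsimp only [Functor.comp_obj, Functor.id_obj] at h ⊢
  rw [L.map_comp, Category.assoc, Category.assoc, h, adj.counit_naturality]

/-- If `T' R ≅ R T`, an adjunction `L ⊣ R` lifts to categories of coalgebras. -/
noncomputable def coalgAdj (adj : L ⊣ R) (ψ : T' ⋙ R ⟶ R ⋙ T) [IsIso ψ] :
    coalgLift L (mateOfIso adj ψ) ⊣ coalgLift R ψ :=
  { unit :=
      { app := fun X => ⟨adj.unit.app X.V, comp_map_unit adj ψ X.str⟩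
        naturality := fun _ _ f => Endofunctor.Coalgebra.ext (adj.unit.naturality f.f) }
    counit :=
      { app := fun Y => ⟨adj.counit.app Y.V, comp_map_counit adj ψ Y.str⟩
        naturality := fun _ _ f => Endofunctor.Coalgebra.ext (adj.counit.naturality f.f) }
    left_triangle_components := fun X =>
      Endofunctor.Coalgebra.ext (adj.left_triangle_components X.V)
    right_triangle_components := fun Y =>
      Endofunctor.Coalgebra.ext (adj.right_triangle_components Y.V) }

theorem coalgAdj_liesOver (adj : L ⊣ R) (ψ : T' ⋙ R ⟶ R ⋙ T) [IsIso ψ] :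
    LiesOver (coalgAdj adj ψ) adj :=
  ⟨fun _ => rfl, fun _ => rfl⟩

variable {V : Type v} [CommMonoid V] [CompleteLattice V]

theorem LiesOver.isEnrichedAdjunction {adj : L ⊣ R} {φ : T ⋙ L ⟶ L ⋙ T'}
    {ψ : T' ⋙ R ⟶ R ⋙ T} {adj' : coalgLift L φ ⊣ coalgLift R ψ} (h : LiesOver adj' adj)
    {EC : Enrichment V C} {ED : Enrichment V D} (hadj : IsEnrichedAdjunction EC ED adj) :
    IsEnrichedAdjunction (coalgEnr EC T) (coalgEnr ED T') adj' where
  left _ _ f g := hadj.left f.f g.f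
  right _ _ f g := hadj.right f.f g.f
  dist_homEquiv X Y f g := by
    have key : ∀ k : (coalgLift L φ).obj X ⟶ Y,
        (adj'.homEquiv X Y k).f = adj.homEquiv X.V Y.V k.f := fun k => by
      -- The unit determines the hom bijection, so a lifted unit gives the base bijection on
      -- underlying morphisms.
      rw [adj'.homEquiv_unit]
      refine Eq.trans ?_ (adj.homEquiv_unit _ _ _).symm
      exact congrArg (· ≫ R.map k.f) (h.1 X)
    change EC.dist _ _ = ED.dist _ _
    rw [key, key]
    exact hadj.dist_homEquiv f.f g.f

theorem IsEnrichedFullyFaithful.coalgLift {EC : Enrichment V C} {ED : Enrichment V D}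
    (h : IsEnrichedFullyFaithful ED EC R) (ψ : T' ⋙ R ⟶ R ⋙ T) [IsIso ψ] :
    IsEnrichedFullyFaithful (coalgEnr ED T') (coalgEnr EC T) (coalgLift R ψ) where
  bijective X Y := by
    refine ⟨fun f g hfg => ?_, fun g => ?_⟩
    · apply Endofunctor.Coalgebra.ext
      exact (h.bijective X.V Y.V).1 (congrArg Endofunctor.Coalgebra.Hom.f hfg)
    · obtain ⟨k, hk⟩ := (h.bijective X.V Y.V).2 g.f
      dsimp only at hk
      -- The preimage `k` is a coalgebra morphism because its square commutes after applying the
      -- faithful `R` and the monomorphism `ψ`.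
      refine ⟨⟨k, (h.bijective X.V (T'.obj Y.V)).1 ?_⟩, Endofunctor.Coalgebra.ext hk⟩
      have hg : (R.map X.str ≫ ψ.app X.V) ≫ T.map g.f = g.f ≫ R.map Y.str ≫ ψ.app Y.V := g.h
      have hn : R.map (T'.map k) ≫ ψ.app Y.V = ψ.app X.V ≫ T.map (R.map k) := ψ.naturality k
      rw [← hk] at hg
      have hg' : R.map (X.str ≫ T'.map k) ≫ ψ.app Y.V = R.map (k ≫ Y.str) ≫ ψ.app Y.V := by
        rw [R.map_comp, R.map_comp, Category.assoc, Category.assoc, hn, ← Category.assoc]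
        exact hg
      exact (cancel_mono (ψ.app Y.V)).1 hg'
  dist_map _ _ f g := h.dist_map f.f g.f

end Lift

/-! ### Composition of enriched fully faithful functors and of enriched adjunctions -/

section Enriched

variable {V : Type v} [CommMonoid V] [CompleteLattice V]
variable {C : Type w₁} [Category.{w₂} C] {D : Type w₃} [Category.{w₄} D]
  {E : Type w₅} [Category.{w₆} E]
variable {EC : Enrichment V C} {ED : Enrichment V D} {EE : Enrichment V E}

theorem IsEnrichedFullyFaithful.comp {F : C ⥤ D} {G : D ⥤ E}
    (hF : IsEnrichedFullyFaithful EC ED F) (hG : IsEnrichedFullyFaithful ED EE G) :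
    IsEnrichedFullyFaithful EC EE (F ⋙ G) where
  bijective X Y := (hG.bijective _ _).comp (hF.bijective X Y)
  dist_map _ _ f g := (hG.dist_map _ _).trans (hF.dist_map f g)

theorem IsEnrichedFullyFaithful.full {F : C ⥤ D} (h : IsEnrichedFullyFaithful EC ED F) :
    F.Full :=
  ⟨fun {X Y} => (h.bijective X Y).2⟩

theorem IsEnrichedFullyFaithful.faithful {F : C ⥤ D} (h : IsEnrichedFullyFaithful EC ED F) :
    F.Faithful :=
  ⟨fun {X Y} _ _ hfg => (h.bijective X Y).1 hfg⟩

theorem IsEnrichedAdjunction.comp {L : C ⥤ D} {R : D ⥤ C} {L' : D ⥤ E} {R' : E ⥤ D}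
    {adj : L ⊣ R} {adj' : L' ⊣ R'} (h : IsEnrichedAdjunction EC ED adj)
    (h' : IsEnrichedAdjunction ED EE adj') : IsEnrichedAdjunction EC EE (adj.comp adj') where
  left _ _ f g := (h.left f g).trans (h'.left _ _)
  right _ _ f g := (h'.right f g).trans (h.right _ _)
  dist_homEquiv X Y f g := by
    rw [Adjunction.comp_homEquiv]
    exact (h.dist_homEquiv _ _).trans (h'.dist_homEquiv f g)

end Enriched

/-! ### Terminal objects of reflective subcategories -/

section Terminal

variable {C : Type w₁} [Category.{w₂} C] {D : Type w₃} [Category.{w₄} D]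
  {L : C ⥤ D} {R : D ⥤ C}

/-- Right adjoints preserve terminal objects, and fully faithful functors reflect them. -/
theorem nonempty_isTerminal_iff_map (adj : L ⊣ R) [R.Full] [R.Faithful] (Z : D) :
    Nonempty (IsTerminal Z) ↔ Nonempty (IsTerminal (R.obj Z)) := by
  have := adj.rightAdjoint_preservesLimits
  exact ⟨fun ⟨h⟩ => ⟨h.isTerminalObj R Z⟩, fun ⟨h⟩ => ⟨h.isTerminalOfObj R Z⟩⟩

theorem exists_isTerminal_map_iso (adj : L ⊣ R) [R.Full] [R.Faithful] (W : C)
    (hW : IsTerminal W) : ∃ Z : D, Nonempty (IsTerminal Z) ∧ Nonempty (R.obj Z ≅ W) := by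
  have hr : adj.unit.app W ≫ hW.from (R.obj (L.obj W)) = 𝟙 W := hW.hom_ext _ _
  obtain ⟨k, hk⟩ := R.map_surjective (hW.from (R.obj (L.obj W)) ≫ adj.unit.app W)
  -- Both sides transpose to the unit at `W`, as `hr` cancels the retraction.
  have hk' : k = 𝟙 _ := by
    apply (adj.homEquiv _ _).injective
    rw [adj.homEquiv_unit, adj.homEquiv_unit, hk, reassoc_of% hr, R.map_id]
    exact (Category.comp_id _).symm
  let e : R.obj (L.obj W) ≅ W :=
    ⟨hW.from _, adj.unit.app W, by rw [← hk, hk', R.map_id], hr⟩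
  exact ⟨L.obj W, (nonempty_isTerminal_iff_map adj _).2 ⟨hW.ofIso e.symm⟩, ⟨e⟩⟩

end Terminal

/-! ### Uniqueness of enriched left Kan extensions -/

section Kan

variable {V : Type v} [CommMonoid V] [CompleteLattice V] [IsQuantale V]
variable {A : Type w₁} [Category.{w₂} A] {B : Type w₃} [Category.{w₄} B]
  {X : Type w₅} [Category.{w₆} X]
  {EB : Enrichment V B} {EX : Enrichment V X} {J : A ⥤ B} {H : A ⥤ X}
  {L L' : B ⥤ X} {α : H ⟶ J ⋙ L} {α' : H ⟶ J ⋙ L'}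

namespace IsLeftKanExtension

theorem hom_ext (h : IsLeftKanExtension EB EX J H L α) {b : B} {x : X} {φ ψ : L.obj b ⟶ x}
    (w : ∀ (a : A) (f : J.obj a ⟶ b), α.app a ≫ L.map f ≫ φ = α.app a ≫ L.map f ≫ ψ) : φ = ψ :=
  (h.bijective b x).1 (PresheafHom.ext (funext fun a => funext fun f => w a f))

theorem exists_hom (h : IsLeftKanExtension EB EX J H L α) {b : B} {x : X}
    (σ : PresheafHom EB EX J H b x) :
    ∃ φ : L.obj b ⟶ x, ∀ (a : A) (f : J.obj a ⟶ b), α.app a ≫ L.map f ≫ φ = σ.app a f := by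
  obtain ⟨φ, hφ⟩ := (h.bijective b x).2 σ
  exact ⟨φ, fun a f => by rw [← hφ]; rfl⟩

/-- The component at `b` corresponds to the identity of `L' b`, regarded through `α'` as a map of
weights. -/
theorem exists_natTrans (h : IsLeftKanExtension EB EX J H L α)
    (h' : IsEnrichedFunctor EB EX L') (α' : H ⟶ J ⋙ L') :
    ∃ θ : L ⟶ L', ∀ (b : B) (a : A) (f : J.obj a ⟶ b),
      α.app a ≫ L.map f ≫ θ.app b = α'.app a ≫ L'.map f := by
  choose θ hθ using fun b => h.exists_hom
    (PresheafHom.ofHom EB EX J H L' h' α' b (L'.obj b) (𝟙 _))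
  have hθ' : ∀ (b : B) (a : A) (f : J.obj a ⟶ b),
      α.app a ≫ L.map f ≫ θ b = α'.app a ≫ L'.map f := fun b a f => by
    rw [hθ]; simp [PresheafHom.ofHom]
  refine ⟨⟨θ, fun b b' g => h.hom_ext fun a f => ?_⟩, hθ'⟩
  rw [← L.map_comp_assoc, hθ', reassoc_of% hθ' b a f, L'.map_comp]

theorem exists_iso (h : IsLeftKanExtension EB EX J H L α)
    (h' : IsLeftKanExtension EB EX J H L' α') :
    ∃ θ : L ≅ L', ∀ a : A, α.app a ≫ θ.hom.app (J.obj a) = α'.app a := by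
  obtain ⟨θ, hθ⟩ := h.exists_natTrans h'.enriched α'
  obtain ⟨η, hη⟩ := h'.exists_natTrans h.enriched α
  refine ⟨⟨θ, η, ?_, ?_⟩, fun a => by simpa using hθ _ a (𝟙 _)⟩
  · ext b
    refine h.hom_ext fun a f => ?_
    rw [NatTrans.comp_app, reassoc_of% hθ b a f, hη]
    simp
  · ext b
    refine h'.hom_ext fun a f => ?_
    rw [NatTrans.comp_app, reassoc_of% hη b a f, hθ]
    simp

end IsLeftKanExtension

end Kan

end VCatCoalg

namespace VCatCoalg

/-! ### The base adjunctions -/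

section Base

variable (V : Type v) [CommMonoid V] [CompleteLattice V]

theorem Two.holds_iInf {ι : Sort w} (p : ι → Two) : (⨅ i, p i).Holds ↔ ∀ i, (p i).Holds :=
  ⟨fun h i => iInf_le p i h, fun h => (le_iInf fun i _ => h i : (⊤ : Two) ≤ ⨅ i, p i) trivial⟩

variable [IsQuantale V]

theorem holds_discObj_hom {S : Type u} (x y : S) :
    ((discObj Two S).hom x y).Holds ↔ x = y := by
  refine ⟨fun h => ?_, fun h => ?_⟩
  · by_contra hne
    exact (discObj_hom_ne Two hne).le h
  · rw [discObj_hom_eq Two h]; trivial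

theorem preordEnr_dist_eq_one {P Q : PreordCat.{u}} {f g : P ⟶ Q}
    (h : ∀ x, (Q.hom (VCat.Hom.toFun f x) (VCat.Hom.toFun g x)).Holds) :
    (preordEnr V).dist f g = 1 :=
  Two.emb_true ((Two.holds_iInf _).2 h)

theorem preordEnr_dist_eq_bot {P Q : PreordCat.{u}} {f g : P ⟶ Q}
    (h : ¬ ∀ x, (Q.hom (VCat.Hom.toFun f x) (VCat.Hom.toFun g x)).Holds) :
    (preordEnr V).dist f g = ⊥ :=
  Two.emb_false fun h' => h ((Two.holds_iInf _).1 h')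

theorem disc_isEnrichedFullyFaithful :
    IsEnrichedFullyFaithful (setEnr.{u} V) (preordEnr V) (disc Two) where
  bijective X Y := by
    refine ⟨fun f g h => ?_, fun g => ⟨TypeCat.ofHom g.toFun, rfl⟩⟩
    ext x
    exact congrFun (congrArg VCat.Hom.toFun h) x
  dist_map X Y f g := by
    by_cases h : f = g
    · subst h
      exact (preordEnr_dist_eq_one V fun x => (holds_discObj_hom _ _).2 rfl).trans
        (discObj_hom_eq V rfl).symm
    · rw [preordEnr_dist_eq_bot V fun h' => h (by ext x; exact (holds_discObj_hom _ _).1 (h' x))]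
      exact (discObj_hom_ne V h).symm

theorem connAdj_isEnrichedAdjunction :
    IsEnrichedAdjunction (preordEnr V) (setEnr V) connAdj.{u} where
  left P Q f g := by
    by_cases h : ∀ x, (Q.hom (VCat.Hom.toFun f x) (VCat.Hom.toFun g x)).Holds
    -- Comparable points lie in one component, so `C` identifies comparable maps.
    · have hc : conn.map f = conn.map g := by
        ext x
        induction x using Quot.ind
        exact Quot.sound (h _)
      rw [preordEnr_dist_eq_one V h, hc]
      exact (setEnr V).one_le_dist _
    · rw [preordEnr_dist_eq_bot V h]
      exact bot_le
  right _ _ f g := ((disc_isEnrichedFullyFaithful V).dist_map f g).ge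
  dist_homEquiv P S f g := by
    by_cases h : f = g
    · subst h
      rw [preordEnr_dist_eq_one V fun x => P_refl _ _]
      exact (discObj_hom_eq V rfl).symm
    · rw [preordEnr_dist_eq_bot V fun h' => h ?_]
      · exact (discObj_hom_ne V h).symm
      · ext x
        induction x using Quot.ind
        exact (holds_discObj_hom _ _).1 (h' _)
where
  P_refl (Q : PreordCat.{u}) (x : Q.carrier) : (Q.hom x x).Holds := Q.one_le_hom x trivial

end Base

/-! ### The enriched adjunction between preorders and `V`-categories -/

section CStar

variable (V : Type v) [CommMonoid V] [CompleteLattice V]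

/-- Integrality matters for the empty infimum, where `1` has to be `⊤`. This is why `dStar`
preserves distances exactly. -/
theorem Two.emb_iInf [IsIntegralNoZeroDiv V] {ι : Sort w} (p : ι → Two) :
    emb V (⨅ i, p i) = ⨅ i, emb V (p i) := by
  by_cases h : ∀ i, (p i).Holds
  · rw [emb_true ((holds_iInf p).2 h), IsIntegralNoZeroDiv.one_eq_top]
    exact (eq_top_iff.2 (le_iInf fun i => by
      rw [emb_true (h i), IsIntegralNoZeroDiv.one_eq_top])).symm
  · rw [emb_false fun h' => h ((holds_iInf p).1 h')]
    obtain ⟨i, hi⟩ := not_forall.1 h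
    exact (le_bot_iff.1 ((iInf_le _ i).trans (emb_false hi).le)).symm

variable [IsQuantale V] [IsIntegralNoZeroDiv V]

theorem dStar_isEnrichedFullyFaithful [Nontrivial V] :
    IsEnrichedFullyFaithful (preordEnr.{u} V) (vcatEnr V) (dStar V) where
  bijective P Q := by
    refine ⟨fun f g h => ?_, fun g => ⟨⟨g.toFun, fun x y h => ?_⟩, rfl⟩⟩
    · exact VCat.Hom.ext (congrArg (VCat.Hom.toFun (V := V)) h)
    · by_contra hne
      have := (g.hom_le x y).trans (Two.emb_false hne).le
      exact one_ne_bot (V := V) (le_bot_iff.1 ((Two.emb_true h).ge.trans this))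
  dist_map P Q f g := (Two.emb_iInf V _).symm

theorem cStarAdj_isEnrichedAdjunction [Nontrivial V] :
    IsEnrichedAdjunction (vcatEnr V) (preordEnr V) (cStarAdj.{u} V) where
  left X Y f g := by
    by_cases h : ∀ x, Y.hom (VCat.Hom.toFun f x) (VCat.Hom.toFun g x) ≠ ⊥
    · rw [preordEnr_dist_eq_one V h, IsIntegralNoZeroDiv.one_eq_top]
      exact le_top
    · obtain ⟨x, hx⟩ := not_forall.1 h
      exact (iInf_le _ x).trans ((not_not.1 hx).le.trans bot_le)
  right _ _ f g := ((dStar_isEnrichedFullyFaithful V).dist_map f g).ge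
  dist_homEquiv X P f g := (Two.emb_iInf V _).symm

end CStar

/-! ### The `V-cat`-ification of an endofunctor of `Set` -/

section Ext

variable {V : Type v} [CommMonoid V] [CompleteLattice V] (T : Type u ⥤ Type u)

/-- A `V`-category structure `d` on the set `T X` such that the action of `T` on functions into
`X` does not decrease distances. -/
structure IsExtDist (X : VCat.{u} V) (d : T.obj X.carrier → T.obj X.carrier → V) : Prop where
  one_le : ∀ s, 1 ≤ d s s
  mul_le : ∀ s t r, d s t * d t r ≤ d s r
  map_le : ∀ (a : Type u) (f g : a ⟶ X.carrier) (t : T.obj a),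
    ⨅ x : a, X.hom (f x) (g x) ≤ d (T.map f t) (T.map g t)

variable [IsQuantale V]

/-- The smallest structure satisfying `IsExtDist`. -/
def extObj (X : VCat.{u} V) : VCat.{u} V where
  carrier := T.obj X.carrier
  hom s t := ⨅ (d : T.obj X.carrier → T.obj X.carrier → V) (_ : IsExtDist T X d), d s t
  one_le_hom s := le_iInf₂ fun _ h => h.one_le s
  hom_mul_hom_le s t r := le_iInf₂ fun d h =>
    (mul_mono' (iInf₂_le d h) (iInf₂_le d h)).trans (h.mul_le s t r)

variable {T}

/-- Together with `le_extObj_hom`: the infimum of all admissible structures is the least one and is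
itself admissible. -/
theorem extObj_hom_le {X : VCat.{u} V} {d : T.obj X.carrier → T.obj X.carrier → V}
    (h : IsExtDist T X d) (s t : T.obj X.carrier) : (extObj T X).hom s t ≤ d s t :=
  iInf₂_le d h

theorem le_extObj_hom (X : VCat.{u} V) {a : Type u} (f g : a ⟶ X.carrier) (t : T.obj a) :
    ⨅ x : a, X.hom (f x) (g x) ≤ (extObj T X).hom (T.map f t) (T.map g t) :=
  le_iInf₂ fun _ h => h.map_le a f g t

/-- A function out of `extObj T X` is a `V`-functor as soon as its composites with `T f`, for `f`
ranging over the functions into `X`, do not decrease distances. -/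
def extLift {X Y : VCat.{u} V} (h : T.obj X.carrier → Y.carrier)
    (hh : ∀ (a : Type u) (f g : a ⟶ X.carrier) (t : T.obj a),
      ⨅ x : a, X.hom (f x) (g x) ≤ Y.hom (h (T.map f t)) (h (T.map g t))) :
    extObj T X ⟶ Y where
  toFun := h
  hom_le := extObj_hom_le
    { one_le := fun _ => Y.one_le_hom _
      mul_le := fun _ _ _ => Y.hom_mul_hom_le _ _ _
      map_le := hh }

variable (T V)

/-- The explicit `V-cat`-ification of `T`, which is `T` on underlying sets. -/
def extFunctor : VCat.{u} V ⥤ VCat.{u} V where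
  obj X := extObj T X
  map {X Y} k := extLift (T.map (TypeCat.ofHom (VCat.Hom.toFun k))) fun a f g t => by
    rw [← comp_apply, ← comp_apply, ← T.map_comp, ← T.map_comp]
    exact (iInf_mono fun x => VCat.Hom.hom_le k _ _).trans 
      (le_extObj_hom Y (f ≫ TypeCat.ofHom (VCat.Hom.toFun k))
        (g ≫ TypeCat.ofHom (VCat.Hom.toFun k)) t)
  map_id X := VCat.Hom.ext (congrArg (fun k : T.obj X.carrier ⟶ T.obj X.carrier =>
    (k : T.obj X.carrier → T.obj X.carrier)) (T.map_id X.carrier))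
  map_comp {X Y Z} k l := VCat.Hom.ext (congrArg (fun k : T.obj X.carrier ⟶ T.obj Z.carrier =>
    (k : T.obj X.carrier → T.obj Z.carrier))
      (T.map_comp (TypeCat.ofHom (VCat.Hom.toFun k)) (TypeCat.ofHom (VCat.Hom.toFun l))))

/-- The unit of the explicit `V-cat`-ification, which is the identity on underlying sets. -/
noncomputable def extUnit : T ⋙ disc V ⟶ disc V ⋙ extFunctor V T where
  app S := discLift (X := extObj T (discObj V S)) (fun t => t)

theorem ext_isEnrichedFunctor : IsEnrichedFunctor (vcatEnr V) (vcatEnr V) (extFunctor.{u} V T) :=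
  fun _ Y f g => le_iInf fun t => le_extObj_hom Y (TypeCat.ofHom (VCat.Hom.toFun f))
    (TypeCat.ofHom (VCat.Hom.toFun g)) t

theorem extUnit_comp_map_comp {X Y : VCat.{u} V} (k : (extFunctor V T).obj X ⟶ Y)
    (t : T.obj X.carrier) :
    VCat.Hom.toFun ((extUnit V T).app X.carrier ≫
      (extFunctor V T).map (discLift (X := X) fun x => x) ≫ k) t = VCat.Hom.toFun k t :=
  congrArg (VCat.Hom.toFun k) (congrArg (fun k : T.obj X.carrier ⟶ T.obj X.carrier => k t)
    (T.map_id X.carrier))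

variable {V T} in
-- Yoneda reduction: naturality along `f` determines `σ` from its value at the identity function on
-- the carrier of `X`.
theorem PresheafHom.app_eq_comp {X Y : VCat.{u} V}
    (σ : PresheafHom (vcatEnr V) (vcatEnr V) (disc V) (T ⋙ disc V) X Y) {a : Type u}
    (f : a ⟶ X.carrier) :
    σ.app a (discLift (X := X) fun x => f x) =
      (disc V).map (T.map f) ≫ σ.app X.carrier (discLift (X := X) fun x => x) :=
  σ.naturality f (discLift (X := X) fun x => x)

theorem isVCatification_ext : IsVCatification V T (extFunctor V T) (extUnit V T) where
  enriched := ext_isEnrichedFunctor V T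
  bijective X Y := by
    refine ⟨fun φ ψ h => VCat.Hom.ext (funext fun t => ?_), fun σ => ?_⟩
    · exact (extUnit_comp_map_comp V T φ t).symm.trans ((congrArg
        (fun σ : PresheafHom (vcatEnr V) (vcatEnr V) (disc V) (T ⋙ disc V) X Y =>
          VCat.Hom.toFun (σ.app X.carrier (discLift (X := X) fun x => x)) t) h).trans
        (extUnit_comp_map_comp V T ψ t))
    -- By the Yoneda reduction, the underlying function of `σ₀` is the only candidate; `σ.dist_le`
    -- supplies the inequalities that make it a `V`-functor.
    · let σ₀ : (disc V).obj (T.obj X.carrier) ⟶ Y :=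
        σ.app X.carrier (discLift (X := X) fun x => x)
      refine ⟨extLift (T := T) (X := X) (Y := Y) (VCat.Hom.toFun σ₀) fun a f g t => ?_,
        PresheafHom.ext (funext fun a => funext fun f =>
          (σ.app_eq_comp (TypeCat.ofHom (VCat.Hom.toFun f))).symm)⟩
      have h := (σ.dist_le a (discLift (X := X) fun x => f x)
        (discLift (X := X) fun x => g x)).trans (iInf_le _ t)
      rw [σ.app_eq_comp, σ.app_eq_comp] at h
      exact h
  dist_eq X Y φ ψ := by
    apply le_antisymm
    -- The identity function on the carrier already tests every point of `T X`.
    · exact le_iInf fun t => ((iInf₂_le X.carrier (discLift (X := X) fun x => x)).trans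
        (iInf_le _ t)).trans (congrArg₂ Y.hom (extUnit_comp_map_comp V T φ t)
          (extUnit_comp_map_comp V T ψ t)).le
    · exact le_iInf₂ fun a f => le_iInf fun t =>
        iInf_le (fun s => Y.hom (VCat.Hom.toFun φ s) (VCat.Hom.toFun ψ s)) _

/-! ### Values of the explicit extension on discrete objects and on preorders -/

section Integral

variable [IsIntegralNoZeroDiv V]

/-- Distinct functions into a discrete object have distance `⊥`, and equal ones impose nothing
beyond reflexivity because `1 = ⊤`. -/
theorem isExtDist_disc (S : Type u) : IsExtDist T (discObj V S) (discObj V (T.obj S)).hom where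
  one_le := (discObj V (T.obj S)).one_le_hom
  mul_le := (discObj V (T.obj S)).hom_mul_hom_le
  map_le a f g t := by
    by_cases h : f = g
    · subst h
      exact le_top.trans (IsIntegralNoZeroDiv.one_eq_top.ge.trans
        ((discObj V (T.obj S)).one_le_hom _))
    · obtain ⟨x, hx⟩ : ∃ x, f x ≠ g x := by
        by_contra! h'
        exact h (by ext x; exact h' x)
      exact (iInf_le _ x).trans ((discObj_hom_ne V hx).le.trans bot_le)

theorem isIso_extUnit : IsIso (extUnit V T) := by
  have (S : Type u) : IsIso ((extUnit V T).app S) :=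
    ⟨{ toFun := fun t => t, hom_le := extObj_hom_le (isExtDist_disc V T S) :
        VCat.Hom (extObj T (discObj V S)) (discObj V (T.obj S)) }, rfl, rfl⟩
  exact NatIso.isIso_of_isIso_app _

theorem isExtDist_dStar (P : PreordCat.{u}) :
    IsExtDist T (dStarObj V P) (dStarObj V (extObj T P)).hom where
  one_le := (dStarObj V (extObj T P)).one_le_hom
  mul_le := (dStarObj V (extObj T P)).hom_mul_hom_le
  map_le _ f g t := (Two.emb_iInf V _).ge.trans (Two.emb_mono (le_extObj_hom P f g t))

/-- The predicate `1 ≤ r` is right adjoint to `Two.emb`. Pulling back along it turns the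
`V`-structure into an admissible preorder, which must contain the least one. -/
theorem isExtDist_one_le (P : PreordCat.{u}) :
    IsExtDist T P fun s t => Two.of (1 ≤ (extObj T (dStarObj V P)).hom s t) where
  one_le s _ := (extObj T (dStarObj V P)).one_le_hom s
  mul_le s t r h := by
    refine le_trans ?_ ((extObj T (dStarObj V P)).hom_mul_hom_le s t r)
    exact (mul_one (1 : V)).ge.trans (mul_mono' h.1 h.2)
  map_le _ f g t h := by
    refine le_trans ?_ (le_extObj_hom (dStarObj V P) f g t)
    exact (Two.emb_true h).ge.trans (Two.emb_iInf V _).le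

theorem dStarObj_extObj_hom_le (P : PreordCat.{u}) (s t : T.obj P.carrier) :
    (dStarObj V (extObj T P)).hom s t ≤ (extObj T (dStarObj V P)).hom s t := by
  by_cases h : ((extObj T P).hom s t).Holds
  · exact (Two.emb_true h).le.trans (extObj_hom_le (isExtDist_one_le V T P) s t h)
  · exact (Two.emb_false h).le.trans bot_le

/-- The explicit `V-cat`-ification extends the explicit `Preord`-ification. -/
noncomputable def extIso : extFunctor.{u} Two T ⋙ dStar V ≅ dStar V ⋙ extFunctor V T :=
  NatIso.ofComponents (fun P =>
    { hom := { toFun := fun t => t, hom_le := dStarObj_extObj_hom_le V T P :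
        VCat.Hom (dStarObj V (extObj T P)) (extObj T (dStarObj V P)) }
      inv := { toFun := fun t => t, hom_le := extObj_hom_le (isExtDist_dStar V T P) :
        VCat.Hom (extObj T (dStarObj V P)) (dStarObj V (extObj T P)) }
      hom_inv_id := rfl
      inv_hom_id := rfl }) (fun _ => rfl)

end Integral

/-- Lets `IsVCatification.isIso` apply to the `Preord`-ification too. -/
instance : IsIntegralNoZeroDiv Two where
  one_eq_top := rfl
  eq_bot_or_eq_bot r s h := by
    by_contra! h'
    exact h'.1 (le_bot_iff.1 fun hr => absurd hr fun hr => h'.2 (le_bot_iff.1 fun hs =>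
      h.le ⟨hr, hs⟩))

variable {V T}

theorem IsVCatification.isIso [IsIntegralNoZeroDiv V] {TV : VCat.{u} V ⥤ VCat.{u} V}
    {α : T ⋙ disc V ⟶ disc V ⋙ TV} (h : IsVCatification V T TV α) : IsIso α := by
  obtain ⟨θ, hθ⟩ := (isVCatification_ext V T).exists_iso h
  have := isIso_extUnit V T
  have e : α = extUnit V T ≫ Functor.whiskerLeft (disc V) θ.hom :=
    NatTrans.ext (funext fun S => (hθ S).symm)
  rw [e]
  infer_instance

theorem IsVCatification.exists_iso_dStar [IsIntegralNoZeroDiv V]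
    {T₂ : PreordCat.{u} ⥤ PreordCat.{u}} {α₂ : T ⋙ disc Two ⟶ disc Two ⋙ T₂}
    {TV : VCat.{u} V ⥤ VCat.{u} V} {αV : T ⋙ disc V ⟶ disc V ⋙ TV}
    (h₂ : IsVCatification Two T T₂ α₂) (hV : IsVCatification V T TV αV) :
    ∃ ψ : T₂ ⋙ dStar V ⟶ dStar V ⋙ TV, IsIso ψ ∧
      ∀ S : Type u, αV.app S ≫ TV.map ((discIso V).hom.app S) =
        (discIso V).hom.app (T.obj S) ≫ (dStar V).map (α₂.app S) ≫
          ψ.app ((disc Two).obj S) := by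
  obtain ⟨θ₂, hθ₂⟩ := h₂.exists_iso (isVCatification_ext Two T)
  obtain ⟨θV, hθV⟩ := (isVCatification_ext V T).exists_iso hV
  refine ⟨Functor.whiskerRight θ₂.hom (dStar V) ≫ (extIso V T).hom ≫
    Functor.whiskerLeft (dStar V) θV.hom, inferInstance, fun S => ?_⟩
  -- For the explicit extensions every map is the identity on points, apart from `T` applied to an
  -- identity.
  have h : (extUnit V T).app S ≫ (extFunctor V T).map ((discIso V).hom.app S) =
      (discIso V).hom.app (T.obj S) ≫ (dStar V).map ((extUnit Two T).app S) ≫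
        (extIso V T).hom.app ((disc Two).obj S) :=
    VCat.Hom.ext (congrArg (fun k : T.obj S ⟶ T.obj S => (k : T.obj S → T.obj S))
      (T.map_id S))
  have hn := θV.hom.naturality ((discIso V).hom.app S)
  dsimp only [Functor.comp_obj] at h hn
  rw [← hθV, Category.assoc]
  dsimp only [Functor.comp_obj]
  rw [← hn, reassoc_of% h, ← hθ₂, Functor.map_comp]
  simp

end Ext

end VCatCoalg

open VCatCoalg in
theorem theorem4p14 (V : Type v) [CommMonoid V] [CompleteLattice V] [IsQuantale V] [Nontrivial V]
    [IsIntegralNoZeroDiv V] (T : Type u ⥤ Type u) :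
    -- the base adjunctions are `V-cat`-adjunctions
    IsEnrichedAdjunction (preordEnr V) (setEnr V) connAdj.{u} ∧
    IsEnrichedAdjunction (vcatEnr V) (preordEnr V) (cStarAdj.{u} V) ∧
    -- `T` has a `Preord`-ification and a `V-cat`-ification
    (∃ (T₂ : PreordCat.{u} ⥤ PreordCat.{u}) (α₂ : T ⋙ disc Two ⟶ disc Two ⋙ T₂),
      IsVCatification Two T T₂ α₂) ∧
    (∃ (TV : VCat.{u} V ⥤ VCat.{u} V) (αV : T ⋙ disc V ⟶ disc V ⋙ TV),
      IsVCatification V T TV αV) ∧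
    -- for any choice of these:
    ∀ (T₂ : PreordCat.{u} ⥤ PreordCat.{u}) (α₂ : T ⋙ disc Two ⟶ disc Two ⋙ T₂)
      (TV : VCat.{u} V ⥤ VCat.{u} V) (αV : T ⋙ disc V ⟶ disc V ⋙ TV),
      IsVCatification Two T T₂ α₂ → IsVCatification V T TV αV →
      -- `T₂` and `TV` are extensions of `T`, and `TV` is an extension of `T₂`
      IsIso α₂ ∧ IsIso αV ∧
      ∃ ψ : T₂ ⋙ dStar V ⟶ dStar V ⋙ TV, IsIso ψ ∧
        (∀ S : Type u, αV.app S ≫ TV.map ((discIso V).hom.app S) =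
          (discIso V).hom.app (T.obj S) ≫ (dStar V).map (α₂.app S) ≫
            ψ.app ((disc Two).obj S)) ∧
        ∃ (φ : T₂ ⋙ conn ⟶ conn ⋙ T) (χ : TV ⋙ cStar V ⟶ cStar V ⋙ T₂)
          (adj₁ : coalgLift conn φ ⊣ coalgLift (disc Two) α₂)
          (adj₂ : coalgLift (cStar V) χ ⊣ coalgLift (dStar V) ψ),
          -- both adjunctions lift to `V-cat`-adjunctions between categories of coalgebras
          LiesOver adj₁ connAdj ∧
          IsEnrichedAdjunction (coalgEnr (preordEnr V) T₂) (coalgEnr (setEnr V) T) adj₁ ∧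
          LiesOver adj₂ (cStarAdj V) ∧
          IsEnrichedAdjunction (coalgEnr (vcatEnr V) TV) (coalgEnr (preordEnr V) T₂) adj₂ ∧
          -- `Coalg(T)` is a full enriched-reflective subcategory of `Coalg(TV)`
          IsEnrichedFullyFaithful (coalgEnr (setEnr V) T) (coalgEnr (vcatEnr V) TV)
            (coalgLift (disc Two) α₂ ⋙ coalgLift (dStar V) ψ) ∧
          IsEnrichedAdjunction (coalgEnr (vcatEnr V) TV) (coalgEnr (setEnr V) T)
            (adj₂.comp adj₁) ∧
          -- the final `T`-coalgebra is the final `TV`-coalgebra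
          (∀ Z : Coalg T, Nonempty (IsTerminal Z) ↔ Nonempty (IsTerminal
            ((coalgLift (disc Two) α₂ ⋙ coalgLift (dStar V) ψ).obj Z))) ∧
          (∀ W : Coalg TV, Nonempty (IsTerminal W) → ∃ Z : Coalg T, Nonempty (IsTerminal Z) ∧
            Nonempty ((coalgLift (disc Two) α₂ ⋙ coalgLift (dStar V) ψ).obj Z ≅ W)) := by
  have hC := connAdj_isEnrichedAdjunction.{u} V
  have hc := cStarAdj_isEnrichedAdjunction.{u} V
  refine ⟨hC, hc, ⟨_, _, isVCatification_ext Two T⟩, ⟨_, _, isVCatification_ext V T⟩,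
    fun T₂ α₂ TV αV h₂ hV => ?_⟩
  -- Invertibility of `α₂` and `ψ` is what provides the mates `φ` and `χ`.
  have hα₂ := h₂.isIso
  obtain ⟨ψ, hψ, hψα⟩ := h₂.exists_iso_dStar hV
  have hff := ((disc_isEnrichedFullyFaithful.{u} V).coalgLift α₂).comp
    ((dStar_isEnrichedFullyFaithful.{u} V).coalgLift ψ)
  have hl₁ := coalgAdj_liesOver connAdj α₂
  have hl₂ := coalgAdj_liesOver (cStarAdj V) ψ
  have h₁' := hl₁.isEnrichedAdjunction hC
  have h₂' := hl₂.isEnrichedAdjunction hc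
  have := hff.full
  have := hff.faithful
  let adj := (coalgAdj (cStarAdj V) ψ).comp (coalgAdj connAdj α₂)
  exact ⟨hα₂, hV.isIso, ψ, hψ, hψα, _, _, coalgAdj connAdj α₂, coalgAdj (cStarAdj V) ψ, hl₁, h₁',
    hl₂, h₂', hff, h₂'.comp h₁', nonempty_isTerminal_iff_map adj,
    fun W ⟨hW⟩ => exists_isTerminal_map_iso adj W hW⟩
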